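/- For $X=(x_1,\dots,x_n)\in\{0,1\}^n$ let $\mathrm{Par}(X)=x_1\oplus\cdots\oplus x_n$. For a randomized or quantum algorithm that queries the bits of $X$ and outputs a bit, let $p(X)$ denote the probability that it accepts (outputs $1$ on) $X$. For $\varepsilon>0$ the algorithm solves $\textsc{WeakPar}_{n,\varepsilon}$ if $$\left|\left\{X\in\{0,1\}^n:\ |p(X)-\mathrm{Par}(X)|\le\tfrac13\right\}\right|\ \ge\ \left(\tfrac12+\varepsilon\right)2^n .$$ A randomized query algorithm is a probability distribution over deterministic decision trees. A quantum query algorithm applies quantum operations and queries $|i,b,z\rangle\mapsto|i,b\oplus x_i,z\rangle$, where the workspace register $z$ has arbitrary dimension; intermediate measurements, on whose outcomes the next instructions may depend, are allowed, and the algorithm halts with probability $1$ on every input. There is an absolute constant $c>0$ (independent of $n$, $\varepsilon$ and the algorithm) such that for all $n$ and all $\varepsilon>0$ the following hold. 1. Let an algorithm solve $\textsc{WeakPar}_{n,\varepsilon}$ with $p(X)\in[0,1/3]\cup[2/3,1]$ for all $X\in\{0,1\}^n$, and let it make at most $T$ queries on every input, whatever the outcomes of its random choices and measurements. If it is randomized,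 then $T\ge c\,n^{1/3}$; if it is quantum, then $T\ge c\,n^{1/6}$. 2. Let an algorithm solve $\textsc{WeakPar}_{n,\varepsilon}$ with $p(X)\in\{0,1\}$ for all $X\in\{0,1\}^n$. If it is randomized, then there is an input on which its expected number of queries is at least $c\,n^{1/2}$; if it is quantum, then there is an input on which its expected number of queries is at least $c\,n^{1/3}$. -/

import Mathlib

open scoped ENNReal

/-- The parity `x₁ ⊕ ⋯ ⊕ xₙ ∈ {0, 1}` of a bit string. -/
def parity {n : ℕ} (X : Fin n → Bool) : ℕ := (∑ i, (X i).toNat) % 2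

/-- An acceptance probability function `p` solves weak parity with advantage `ε`: on at least
a `1/2 + ε` fraction of all the inputs, `p` is within `1/3` of the parity. -/
def SolvesWeakParity {n : ℕ} (p : (Fin n → Bool) → ℝ) (ε : ℝ) : Prop :=
  (1 / 2 + ε) * 2 ^ n ≤ (({X | |p X - (parity X : ℝ)| ≤ 1 / 3} : Set (Fin n → Bool)).ncard : ℝ)

/-! ### Classical query algorithms -/

/-- A deterministic query algorithm on `n` input bits: it outputs a bit, or it queries `x i` and
continues with `t₀` if the answer is `0` and with `t₁` if the answer is `1`. -/
inductive DecisionTree (n : ℕ) : Type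
  | output (b : Bool) : DecisionTree n
  | query (i : Fin n) (t₀ t₁ : DecisionTree n) : DecisionTree n

namespace DecisionTree

/-- The output on input `X`. -/
def eval {n : ℕ} (X : Fin n → Bool) : DecisionTree n → Bool
  | output b => b
  | query i t₀ t₁ => if X i then t₁.eval X else t₀.eval X

/-- The number of queries made on input `X`. -/
def numQueries {n : ℕ} (X : Fin n → Bool) : DecisionTree n → ℕ
  | output _ => 0
  | query i t₀ t₁ => (if X i then t₁.numQueries X else t₀.numQueries X) + 1

end DecisionTree

/-- A randomized query algorithm: a probability distribution on deterministic ones. (There are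
only countably many decision trees, so every distribution on them is a `PMF`. The depth of the
trees in the support may be unbounded.) -/
abbrev RandomizedAlgorithm (n : ℕ) : Type := PMF (DecisionTree n)

namespace RandomizedAlgorithm

variable {n : ℕ}

/-- The probability that the algorithm accepts (outputs `1` on) the input `X`. -/
noncomputable def acceptProb (A : RandomizedAlgorithm n) (X : Fin n → Bool) : ℝ :=
  (PMF.map (DecisionTree.eval X) A true).toReal

/-- On every input, with every outcome of the random choices, at most `T` queries are made. -/
def MakesAtMost (A : RandomizedAlgorithm n) (T : ℕ) : Prop :=
  ∀ X : Fin n → Bool, ∀ t ∈ PMF.support A, t.numQueries X ≤ T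

/-- The expected number of queries made on input `X`. -/
noncomputable def expectedQueries (A : RandomizedAlgorithm n) (X : Fin n → Bool) : ℝ≥0∞ :=
  ∑' t : DecisionTree n, A t * (t.numQueries X : ℝ≥0∞)

end RandomizedAlgorithm

/-! ### Quantum query algorithms -/

/-- The state space of a quantum query algorithm on `n` bits, spanned by vectors `|i, b, z⟩`,
with `i` an index register, `b` an answer bit and `z` in a workspace `W`; that is, the direct
sum of copies of `W` indexed by the pairs `(i, b)`. The workspace may have any dimension. -/
abbrev QState (n : ℕ) (W : Type*) : Type _ := PiLp 2 (fun _ : Fin n × Bool => W)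

/-- The query, which maps `|i, b, z⟩` to `|i, b ⊕ x i, z⟩`. -/
def oracle {n : ℕ} {W : Type*} (X : Fin n → Bool) (v : QState n W) : QState n W :=
  WithLp.toLp 2 fun ib => v (ib.1, xor ib.2 (X ib.1))

/-- A quantum operation with measurement outcomes in the finite set `K`, given by Kraus operators
`op k` with `∑ k, (op k)† (op k) = 1`: outcome `k` turns the (unnormalized) state `v` into
`op k v`. A unitary `U` is the case where one of the operators is `U` and the others are `0`; a
projective measurement is the case where the operators are orthogonal projections of sum `1`. -/
structure QOperation (n : ℕ) (K W : Type*) [Fintype K]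
    [NormedAddCommGroup W] [InnerProductSpace ℂ W] where
  op : K → QState n W →ₗ[ℂ] QState n W
  sum_norm_sq : ∀ v, ∑ k, ‖op k v‖ ^ 2 = ‖v‖ ^ 2

/-- One instruction: halt and output `b`; or make a query if `ask` is `true` (and no query if it
is `false`), then perform the operation `M` and record its outcome. -/
inductive QInstruction (n : ℕ) (K W : Type*) [Fintype K]
    [NormedAddCommGroup W] [InnerProductSpace ℂ W]
  | output (b : Bool) : QInstruction n K W
  | step (ask : Bool) (M : QOperation n K W) : QInstruction n K W

/-- A quantum query program with intermediate measurements: an initial state, and for each history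
of measurement outcomes (latest outcome first) the instruction to carry out next. -/
structure QuantumProgram (n : ℕ) (K W : Type*) [Fintype K]
    [NormedAddCommGroup W] [InnerProductSpace ℂ W] where
  init : QState n W
  norm_init : ‖init‖ = 1
  instr : List K → QInstruction n K W

namespace QuantumProgram

variable {n : ℕ} {K W : Type*} [Fintype K] [NormedAddCommGroup W] [InnerProductSpace ℂ W]

/-- The unnormalized state on input `X` after the history `h`; the square of its norm is the
probability that the history `h` occurs. Nothing follows a history that has led to an output. -/
def state (A : QuantumProgram n K W) (X : Fin n → Bool) : List K → QState n W
  | [] => A.init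
  | k :: h =>
    match A.instr h with
    | .output _ => 0
    | .step ask M => M.op k (if ask then oracle X (A.state X h) else A.state X h)

/-- The number of queries made along the history `h`. -/
def numQueries (A : QuantumProgram n K W) : List K → ℕ
  | [] => 0
  | _ :: h =>
    A.numQueries h +
      match A.instr h with
      | .output _ => 0
      | .step ask _ => if ask then 1 else 0

/-- The probability that on input `X` the program halts with output `b` after exactly the
history `h`. -/
noncomputable def haltProb (A : QuantumProgram n K W) (X : Fin n → Bool) (b : Bool)
    (h : List K) : ℝ≥0∞ :=
  match A.instr h with
  | .output b' => if b' = b then ENNReal.ofReal (‖A.state X h‖ ^ 2) else 0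
  | .step _ _ => 0

/-- The probability that on input `X` the program halts with output `b`. -/
noncomputable def outputProb (A : QuantumProgram n K W) (X : Fin n → Bool) (b : Bool) : ℝ≥0∞ :=
  ∑' h : List K, A.haltProb X b h

end QuantumProgram

/-- A quantum query algorithm: a program that halts with probability `1` on every input. The
usual algorithms, which alternate input-independent unitaries with queries and measure once at
the end, are a special case. -/
structure QuantumAlgorithm (n : ℕ) (K W : Type*) [Fintype K]
    [NormedAddCommGroup W] [InnerProductSpace ℂ W] extends QuantumProgram n K W where
  halts : ∀ X, toQuantumProgram.outputProb X true + toQuantumProgram.outputProb X false = 1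

namespace QuantumAlgorithm

variable {n : ℕ} {K W : Type*} [Fintype K] [NormedAddCommGroup W] [InnerProductSpace ℂ W]

/-- The probability that the algorithm accepts (outputs `1` on) the input `X`. -/
noncomputable def acceptProb (A : QuantumAlgorithm n K W) (X : Fin n → Bool) : ℝ :=
  (A.outputProb X true).toReal

/-- On every input, along every history of positive probability, at most `T` queries are made. -/
def MakesAtMost (A : QuantumAlgorithm n K W) (T : ℕ) : Prop :=
  ∀ (X : Fin n → Bool) (h : List K), A.state X h ≠ 0 → A.numQueries h ≤ T

/-- The expected number of queries made on input `X`. -/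
noncomputable def expectedQueries (A : QuantumAlgorithm n K W) (X : Fin n → Bool) : ℝ≥0∞ :=
  ∑' h : List K, (A.haltProb X true h + A.haltProb X false h) * (A.numQueries h : ℝ≥0∞)

end QuantumAlgorithm

/-! All four bounds follow from a stronger one: on some input the expected number of queries is at
least a constant times `√n`. The argument combines Huang's signed hypercube with the adversary
method. The success set `S` contains more than half of the cube. The signed adjacency operator
squares to `n`, so its `√n`-eigenspace is large enough to contain a nonzero vector supported on `S`
(`exists_eigenvector_signedAdj`). Its absolute value `v` satisfies `∑ v x * v y ≥ √n * ∑ v x ^ 2`,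
the left sum running over ordered adjacent pairs. Parity changes along every edge, so the acceptance
probabilities at the ends of an edge inside `S` differ by at least `1/3`. To tell the two ends
apart, an algorithm must spend query weight on the direction `i` of the edge: `κ * (a * b) ≤ a ^ 2 *
q i x + b ^ 2 * q i y` for all `a, b ≥ 0`. Taking `a = v x`, `b = v y` and summing over the edges
bounds the `v ^ 2`-weighted average of `∑ i, q i x` below by `κ / 2 * √n` (`exists_le_sum_cost`).
Classically `q i x` is the probability that bit `i` is queried (`abs_acceptProb_sub_le`). In the
quantum case it is the expected squared amplitude on index `i` at query times, and the edge
inequality comes from following the inner product of the two runs through the tree of measurement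
outcomes (`mul_le_of_steps`, `mul_le_of_separated`). -/

/-! ### The hypercube -/

/-- The bit string `x` with bit `i` flipped. -/
def flipBit {n : ℕ} (x : Fin n → Bool) (i : Fin n) : Fin n → Bool :=
  Function.update x i (!x i)

section Hypercube

variable {n : ℕ}

@[simp]
theorem flipBit_same (x : Fin n → Bool) (i : Fin n) : flipBit x i i = !x i := by
  simp [flipBit]

theorem flipBit_of_ne (x : Fin n → Bool) {i j : Fin n} (h : j ≠ i) : flipBit x i j = x j := by
  simp [flipBit, h]

@[simp]
theorem flipBit_flipBit (x : Fin n → Bool) (i : Fin n) : flipBit (flipBit x i) i = x := by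
  simp [flipBit]

theorem flipBit_comm (x : Fin n → Bool) (i j : Fin n) :
    flipBit (flipBit x i) j = flipBit (flipBit x j) i := by
  rcases eq_or_ne i j with rfl | h
  · rfl
  · simp only [flipBit, Function.update_of_ne h, Function.update_of_ne h.symm]
    exact Function.update_comm h _ _ _

/-- Flipping bit `i`, as a permutation of the bit strings. -/
def flipEquiv (i : Fin n) : Equiv.Perm (Fin n → Bool) where
  toFun x := flipBit x i
  invFun x := flipBit x i
  left_inv x := flipBit_flipBit x i
  right_inv x := flipBit_flipBit x i

theorem sum_flipBit (g : (Fin n → Bool) → ℝ) (i : Fin n) : ∑ x, g (flipBit x i) = ∑ x, g x :=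
  Equiv.sum_comp (flipEquiv i) g

theorem parity_flipBit (x : Fin n → Bool) (i : Fin n) : parity (flipBit x i) = 1 - parity x := by
  have h : ∀ y : Fin n → Bool,
      ∑ j, (y j).toNat = (y i).toNat + ∑ j ∈ Finset.univ.erase i, (y j).toNat := fun y =>
    (Finset.add_sum_erase _ (fun j => (y j).toNat) (Finset.mem_univ i)).symm
  have h' : ∑ j ∈ Finset.univ.erase i, (flipBit x i j).toNat
      = ∑ j ∈ Finset.univ.erase i, (x j).toNat :=
    Finset.sum_congr rfl fun j hj => by rw [flipBit_of_ne x (Finset.ne_of_mem_erase hj)]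
  unfold parity
  rw [h, h x, h', flipBit_same]
  cases x i <;> simp <;> omega

theorem parity_le_one (x : Fin n → Bool) : parity x ≤ 1 :=
  Nat.le_of_lt_succ (Nat.mod_lt _ two_pos)

/-! ### Huang's signed adjacency operator and its eigenvectors -/

/-- The sign of the edge in direction `i` at `x`. -/
def edgeSign (i : Fin n) (x : Fin n → Bool) : ℝ :=
  ∏ j with j < i, if x j then -1 else 1

theorem abs_edgeSign (i : Fin n) (x : Fin n → Bool) : |edgeSign i x| = 1 := by
  rw [edgeSign, Finset.abs_prod]
  exact Finset.prod_eq_one fun j _ => by split <;> simp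

theorem edgeSign_flipBit_of_lt (x : Fin n → Bool) {i j : Fin n} (h : j < i) :
    edgeSign i (flipBit x j) = -edgeSign i x := by
  have hj : j ∈ Finset.univ.filter (· < i) := by simp [h]
  rw [edgeSign, edgeSign, ← Finset.mul_prod_erase _ _ hj, ← Finset.mul_prod_erase _ _ hj,
    flipBit_same, Finset.prod_congr rfl fun k hk => by
      rw [flipBit_of_ne x (Finset.ne_of_mem_erase hk)]]
  cases x j <;> simp

theorem edgeSign_flipBit_of_le (x : Fin n → Bool) {i j : Fin n} (h : i ≤ j) :
    edgeSign i (flipBit x j) = edgeSign i x :=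
  Finset.prod_congr rfl fun k hk => by
    rw [flipBit_of_ne x ((Finset.mem_filter.1 hk).2.trans_le h).ne]

/-- The signed adjacency operator of the hypercube. -/
def signedAdj (n : ℕ) : ((Fin n → Bool) → ℝ) →ₗ[ℝ] ((Fin n → Bool) → ℝ) where
  toFun u x := ∑ i, edgeSign i x * u (flipBit x i)
  map_add' u v := by
    ext x
    simp [mul_add, Finset.sum_add_distrib]
  map_smul' c u := by
    ext x
    simp only [Pi.smul_apply, smul_eq_mul, Finset.mul_sum, RingHom.id_apply]
    exact Finset.sum_congr rfl fun i _ => by ring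

theorem signedAdj_apply (u : (Fin n → Bool) → ℝ) (x : Fin n → Bool) :
    signedAdj n u x = ∑ i, edgeSign i x * u (flipBit x i) := rfl

/-- The two paths around a square carry opposite signs: for `i < j`, flipping bit `i` negates the
sign of direction `j`, while flipping bit `j` leaves that of direction `i` alone. Only the `n`
back-and-forth paths survive. -/
theorem signedAdj_signedAdj (u : (Fin n → Bool) → ℝ) :
    signedAdj n (signedAdj n u) = (n : ℝ) • u := by
  ext x
  set F : Fin n → Fin n → ℝ := fun i j =>
    edgeSign i x * (edgeSign j (flipBit x i) * u (flipBit (flipBit x i) j)) with hF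
  have h1 : signedAdj n (signedAdj n u) x = ∑ i, ∑ j, F i j := by
    simp only [signedAdj_apply, hF, Finset.mul_sum]
  have h2 : ∀ i j, F i j + F j i = if i = j then 2 * u x else 0 := by
    intro i j
    have hlt : ∀ i j, i < j → F i j + F j i = 0 := by
      intro i j h
      simp only [hF]
      rw [edgeSign_flipBit_of_lt x h, edgeSign_flipBit_of_le x h.le, flipBit_comm x i j]
      ring
    rcases lt_trichotomy i j with h | h | h
    · rw [hlt i j h, if_neg h.ne]
    · subst h
      have hs : edgeSign i x * edgeSign i x = 1 := by
        rw [← abs_mul_abs_self, abs_edgeSign, one_mul]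
      simp only [hF, edgeSign_flipBit_of_le x le_rfl, flipBit_flipBit, if_true]
      linear_combination 2 * u x * hs
    · rw [add_comm, hlt j i h, if_neg h.ne']
  have h3 : ∑ i, ∑ j, F i j + ∑ i, ∑ j, F i j = 2 * ((n : ℝ) * u x) := by
    nth_rw 2 [Finset.sum_comm]
    simp only [← Finset.sum_add_distrib, h2, Finset.sum_ite_eq, Finset.mem_univ, if_true,
      Finset.sum_const, Finset.card_univ, Fintype.card_fin, nsmul_eq_mul]
    ring
  rw [h1, Pi.smul_apply, smul_eq_mul]
  linarith

theorem two_mul_card_parity_zero (hn : 0 < n) :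
    2 * Fintype.card {x : Fin n → Bool // parity x = 0} = 2 ^ n := by
  have e : {x : Fin n → Bool // parity x = 0} ≃ {x : Fin n → Bool // ¬ parity x = 0} :=
    (flipEquiv ⟨0, hn⟩).subtypeEquiv fun x => by
      have h := parity_flipBit x ⟨0, hn⟩
      have h' := parity_le_one x
      change parity x = 0 ↔ ¬ parity (flipBit x ⟨0, hn⟩) = 0
      omega
  have h1 := Fintype.card_congr e
  have h2 := Fintype.card_subtype_compl (fun x : Fin n → Bool => parity x = 0)
  have h3 := Fintype.card_subtype_le (fun x : Fin n → Bool => parity x = 0)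
  have h4 : Fintype.card (Fin n → Bool) = 2 ^ n := by simp
  omega

/-- A set of more than half of the vertices of the hypercube supports an eigenvector of the
signed adjacency operator for the eigenvalue `√n`. -/
theorem exists_eigenvector_signedAdj (hn : 0 < n) {S : Set (Fin n → Bool)}
    (hS : 2 ^ n < 2 * S.ncard) :
    ∃ u : (Fin n → Bool) → ℝ, u ≠ 0 ∧ (∀ x ∉ S, u x = 0) ∧ signedAdj n u = √n • u := by
  classical
  let ext : ({x : Fin n → Bool // parity x = 0} → ℝ) →ₗ[ℝ] ((Fin n → Bool) → ℝ) :=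
    { toFun := fun w x => if h : parity x = 0 then w ⟨x, h⟩ else 0
      map_add' := fun w w' => by ext x; by_cases h : parity x = 0 <;> simp [h]
      map_smul' := fun c w => by ext x; by_cases h : parity x = 0 <;> simp [h] }
  have ext_apply : ∀ w x, ext w x = if h : parity x = 0 then w ⟨x, h⟩ else 0 := fun _ _ => rfl
  -- As the operator squares to `n`, every value of `√n + signedAdj` is an eigenvector for `√n`.
  let Φ : ({x : Fin n → Bool // parity x = 0} → ℝ) →ₗ[ℝ] ((Fin n → Bool) → ℝ) :=
    √n • ext + (signedAdj n).comp ext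
  have hΦ : ∀ w, Φ w = √n • ext w + signedAdj n (ext w) := fun _ => rfl
  let ρ : ((Fin n → Bool) → ℝ) →ₗ[ℝ] ({x : Fin n → Bool // x ∉ S} → ℝ) :=
    LinearMap.funLeft ℝ ℝ Subtype.val
  -- Vanishing off `S` imposes fewer than `2 ^ (n - 1)` linear conditions, while the even inputs
  -- give `2 ^ (n - 1)` parameters.
  have hdim : Module.finrank ℝ ({x : Fin n → Bool // x ∉ S} → ℝ)
      < Module.finrank ℝ ({x : Fin n → Bool // parity x = 0} → ℝ) := by
    rw [Module.finrank_fintype_fun_eq_card, Module.finrank_fintype_fun_eq_card]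
    have h1 := two_mul_card_parity_zero hn
    have h2 : S.ncard + Fintype.card {x : Fin n → Bool // x ∉ S} = 2 ^ n := by
      rw [← Nat.card_eq_fintype_card]
      exact S.ncard_add_ncard_compl.trans (by simp)
    omega
  obtain ⟨w, hw, hw0⟩ := (Submodule.ne_bot_iff _).1
    (LinearMap.ker_ne_bot_of_finrank_lt (f := ρ.comp Φ) hdim)
  have hsq : √(n : ℝ) * √n = n := Real.mul_self_sqrt (Nat.cast_nonneg n)
  refine ⟨Φ w, ?_, ?_, ?_⟩
  · intro h0
    apply hw0
    ext ⟨x, hx⟩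
    -- The operator exchanges even and odd inputs, so on even inputs `Φ w` is just `√n * w`; hence
    -- `Φ` is injective.
    have h1 : signedAdj n (ext w) x = 0 := by
      rw [signedAdj_apply]
      refine Finset.sum_eq_zero fun i _ => ?_
      rw [ext_apply, dif_neg (by rw [parity_flipBit, hx]; omega), mul_zero]
    have h2 := congrFun h0 x
    rw [hΦ, Pi.add_apply, h1, Pi.smul_apply, ext_apply, dif_pos hx, add_zero, smul_eq_mul] at h2
    have h3 : √(n : ℝ) ≠ 0 := (Real.sqrt_pos.2 (Nat.cast_pos.2 hn)).ne'
    simpa [h3] using h2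
  · intro x hx
    exact congrFun (LinearMap.mem_ker.1 hw) ⟨x, hx⟩
  · rw [hΦ, map_add, map_smul, signedAdj_signedAdj, smul_add, smul_smul, hsq, add_comm]

/-- A set of more than half of the vertices of the hypercube induces a subgraph whose adjacency
matrix has spectral radius at least `√n`, witnessed by a nonnegative vector `v`. -/
theorem exists_weight_of_half_lt {S : Set (Fin n → Bool)} (hS : 2 ^ n < 2 * S.ncard) :
    ∃ v : (Fin n → Bool) → ℝ, (∀ x, 0 ≤ v x) ∧ (∀ x ∉ S, v x = 0) ∧ 0 < ∑ x, v x ^ 2 ∧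
      √n * ∑ x, v x ^ 2 ≤ ∑ x, ∑ i, v x * v (flipBit x i) := by
  classical
  rcases Nat.eq_zero_or_pos n with rfl | hn
  · obtain ⟨y, hy⟩ : S.Nonempty := by
      rw [← Set.ncard_pos]
      omega
    refine ⟨fun _ => 1, fun _ => zero_le_one, fun x hx => ?_, by simp, by simp⟩
    exact absurd (Subsingleton.elim y x ▸ hy) hx
  · obtain ⟨u, hu0, huS, hu⟩ := exists_eigenvector_signedAdj hn hS
    refine ⟨fun x => |u x|, fun x => abs_nonneg _, fun x hx => by simp [huS x hx], ?_, ?_⟩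
    · obtain ⟨x, hx⟩ := Function.ne_iff.1 hu0
      exact Finset.sum_pos' (fun x _ => sq_nonneg _)
        ⟨x, Finset.mem_univ x, sq_pos_of_pos (abs_pos.2 hx)⟩
    · rw [Finset.mul_sum]
      refine Finset.sum_le_sum fun x _ => ?_
      have h := congrFun hu x
      rw [signedAdj_apply, Pi.smul_apply, smul_eq_mul] at h
      rw [sq_abs]
      calc √n * u x ^ 2 = u x * (√n * u x) := by ring
        _ = ∑ i, u x * (edgeSign i x * u (flipBit x i)) := by rw [← h, Finset.mul_sum]
        _ ≤ ∑ i, |u x| * |u (flipBit x i)| := Finset.sum_le_sum fun i _ =>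
            (le_abs_self _).trans_eq (by rw [abs_mul, abs_mul, abs_edgeSign, one_mul])

/-! ### From edge costs to a lower bound on total cost -/

/-- If the costs `q i` at the two ends of every edge inside `S` are large in the sense of weighted
geometric means, then the total cost is at least of order `√n` somewhere. -/
theorem exists_le_sum_cost {S : Set (Fin n → Bool)} (hS : 2 ^ n < 2 * S.ncard)
    (q : Fin n → (Fin n → Bool) → ℝ) (hq : ∀ i x, 0 ≤ q i x) {κ : ℝ}
    (h : ∀ i, ∀ x ∈ S, flipBit x i ∈ S → ∀ a b : ℝ, 0 ≤ a → 0 ≤ b →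
      κ * (a * b) ≤ a ^ 2 * q i x + b ^ 2 * q i (flipBit x i)) (hκ : 0 ≤ κ) :
    ∃ x, κ / 2 * √n ≤ ∑ i, q i x := by
  obtain ⟨v, hv0, hvS, hvpos, hv⟩ := exists_weight_of_half_lt hS
  by_contra! hcon
  -- For edges that leave `S` the left side vanishes, so the hypothesis is needed only inside `S`.
  have h1 : ∀ x i, κ * (v x * v (flipBit x i))
      ≤ v x ^ 2 * q i x + v (flipBit x i) ^ 2 * q i (flipBit x i) := by
    intro x i
    have hnn : 0 ≤ v x ^ 2 * q i x + v (flipBit x i) ^ 2 * q i (flipBit x i) := by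
      have := hq i x
      have := hq i (flipBit x i)
      positivity
    by_cases hx : x ∈ S
    · by_cases hy : flipBit x i ∈ S
      · exact h i x hx hy _ _ (hv0 _) (hv0 _)
      · simpa [hvS _ hy] using hnn
    · simpa [hvS _ hx] using hnn
  have h2 : κ * ∑ x, ∑ i, v x * v (flipBit x i) ≤ 2 * ∑ x, v x ^ 2 * ∑ i, q i x := by
    calc κ * ∑ x, ∑ i, v x * v (flipBit x i)
        = ∑ x, ∑ i, κ * (v x * v (flipBit x i)) := by simp only [Finset.mul_sum]
      _ ≤ ∑ x, ∑ i, (v x ^ 2 * q i x + v (flipBit x i) ^ 2 * q i (flipBit x i)) :=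
          Finset.sum_le_sum fun x _ => Finset.sum_le_sum fun i _ => h1 x i
      _ = ∑ x, ∑ i, v x ^ 2 * q i x
            + ∑ i, ∑ x, v (flipBit x i) ^ 2 * q i (flipBit x i) := by
          simp only [Finset.sum_add_distrib]
          rw [Finset.sum_comm (f := fun x i => v (flipBit x i) ^ 2 * q i (flipBit x i))]
      _ = ∑ x, ∑ i, v x ^ 2 * q i x + ∑ i, ∑ x, v x ^ 2 * q i x := by
          congr 1
          exact Finset.sum_congr rfl fun i _ => sum_flipBit (fun x => v x ^ 2 * q i x) i
      _ = 2 * ∑ x, v x ^ 2 * ∑ i, q i x := by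
          rw [Finset.sum_comm (f := fun i x => v x ^ 2 * q i x)]
          simp only [Finset.mul_sum]
          simp only [← Finset.sum_add_distrib]
          exact Finset.sum_congr rfl fun x _ => Finset.sum_congr rfl fun i _ => by ring
  have h3 : ∑ x, v x ^ 2 * ∑ i, q i x < ∑ x, v x ^ 2 * (κ / 2 * √n) := by
    obtain ⟨x, _, hx⟩ := Finset.exists_lt_of_sum_lt
      (by simpa using hvpos : ∑ x : Fin n → Bool, (0 : ℝ) < ∑ x, v x ^ 2)
    exact Finset.sum_lt_sum
      (fun y _ => mul_le_mul_of_nonneg_left (hcon y).le (sq_nonneg _))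
      ⟨x, Finset.mem_univ x, mul_lt_mul_of_pos_left (hcon x) hx⟩
  rw [← Finset.sum_mul] at h3
  have h4 := mul_le_mul_of_nonneg_left hv hκ
  linarith

/-- The inputs on which an algorithm for weak parity succeeds are more than half of all. -/
theorem SolvesWeakParity.two_pow_lt {p : (Fin n → Bool) → ℝ} {ε : ℝ} (hε : 0 < ε)
    (h : SolvesWeakParity p ε) :
    2 ^ n < 2 * ({X | |p X - (parity X : ℝ)| ≤ 1 / 3} : Set (Fin n → Bool)).ncard := by
  unfold SolvesWeakParity at h
  have h2 : (0 : ℝ) < 2 ^ n := by positivity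
  have h3 : (2 : ℝ) ^ n
      < 2 * (({X | |p X - (parity X : ℝ)| ≤ 1 / 3} : Set (Fin n → Bool)).ncard : ℝ) := by
    nlinarith [mul_pos hε h2]
  exact_mod_cast h3

/-- Success at both ends of an edge separates the acceptance probabilities there. -/
theorem separated_of_success {p : (Fin n → Bool) → ℝ} {x : Fin n → Bool} {i : Fin n}
    (hx : |p x - (parity x : ℝ)| ≤ 1 / 3)
    (hy : |p (flipBit x i) - (parity (flipBit x i) : ℝ)| ≤ 1 / 3) :
    p x + 1 / 3 ≤ p (flipBit x i) ∨ p (flipBit x i) + 1 / 3 ≤ p x := by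
  rw [abs_le] at hx hy
  have h := parity_flipBit x i
  have h' := parity_le_one x
  interval_cases hp : parity x
  · left
    norm_num [h] at hx hy
    linarith
  · right
    norm_num [h] at hx hy
    linarith

/-- Positivity of `r` matters at `n = 0`, where `0 ^ 0 = 1`. -/
theorem rpow_le_sqrt {r : ℝ} (h0 : 0 < r) (h1 : r ≤ 1 / 2) (n : ℕ) : (n : ℝ) ^ r ≤ √n := by
  rcases Nat.eq_zero_or_pos n with rfl | hn
  · simp [Real.zero_rpow h0.ne']
  · rw [Real.sqrt_eq_rpow]
    exact Real.rpow_le_rpow_of_exponent_le (by exact_mod_cast hn) h1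

end Hypercube

/-! ### Classical algorithms -/

namespace DecisionTree

variable {n : ℕ}

/-- The set of the variables queried on input `X`. -/
def queried (X : Fin n → Bool) : DecisionTree n → Finset (Fin n)
  | output _ => ∅
  | query i t₀ t₁ => insert i (if X i then t₁.queried X else t₀.queried X)

theorem card_queried_le (X : Fin n → Bool) (t : DecisionTree n) :
    (t.queried X).card ≤ t.numQueries X := by
  induction t with
  | output b => simp [queried]
  | query i t₀ t₁ h₀ h₁ =>
    refine (Finset.card_insert_le _ _).trans ?_
    unfold numQueries
    split <;> omega

theorem eval_flipBit (X : Fin n → Bool) {i : Fin n} (t : DecisionTree n) (h : i ∉ t.queried X) :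
    t.eval (flipBit X i) = t.eval X := by
  induction t with
  | output b => rfl
  | query j t₀ t₁ h₀ h₁ =>
    rw [queried, Finset.mem_insert, not_or] at h
    obtain ⟨hj, h⟩ := h
    unfold eval
    rw [flipBit_of_ne X (Ne.symm hj)]
    split_ifs at h ⊢
    · exact h₁ h
    · exact h₀ h

end DecisionTree

namespace RandomizedAlgorithm

variable {n : ℕ}

/-- The probability that `x i` is queried on input `X`. -/
noncomputable def queryProb (A : RandomizedAlgorithm n) (i : Fin n) (X : Fin n → Bool) : ℝ≥0∞ :=
  ∑' t : DecisionTree n, if i ∈ t.queried X then A t else 0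

theorem queryProb_le_one (A : RandomizedAlgorithm n) (i : Fin n) (X : Fin n → Bool) :
    A.queryProb i X ≤ 1 := by
  rw [← PMF.tsum_coe A]
  exact ENNReal.tsum_le_tsum fun t => by split <;> simp

theorem map_eval_apply (A : RandomizedAlgorithm n) (X : Fin n → Bool) :
    PMF.map (DecisionTree.eval X) A true = ∑' t, if t.eval X then A t else 0 := by
  rw [PMF.map_apply]
  exact tsum_congr fun t => by cases t.eval X <;> simp

/-- Trees that do not query `i` on `X` give the same output at both ends of the edge. By symmetry
the bound also holds with the query probability at the other end. -/
theorem abs_acceptProb_sub_le (A : RandomizedAlgorithm n) (i : Fin n) (X : Fin n → Bool) :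
    |A.acceptProb X - A.acceptProb (flipBit X i)| ≤ (A.queryProb i X).toReal := by
  have hq : A.queryProb i X ≠ ∞ := ((A.queryProb_le_one i X).trans_lt ENNReal.one_lt_top).ne
  have key : ∀ Y Z : Fin n → Bool,
      (∀ t : DecisionTree n, i ∉ t.queried X → t.eval Y = t.eval Z) →
      A.acceptProb Y ≤ A.acceptProb Z + (A.queryProb i X).toReal := by
    intro Y Z h
    unfold acceptProb
    rw [← ENNReal.toReal_add (PMF.apply_ne_top _ _) hq]
    refine ENNReal.toReal_mono (ENNReal.add_ne_top.2 ⟨PMF.apply_ne_top _ _, hq⟩) ?_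
    rw [map_eval_apply, map_eval_apply, queryProb, ← ENNReal.tsum_add]
    refine ENNReal.tsum_le_tsum fun t => ?_
    by_cases ht : i ∈ t.queried X
    · rw [if_pos ht]
      split
      · exact le_add_self
      · exact zero_le
    · rw [h t ht]
      exact le_self_add
  rw [abs_sub_le_iff]
  constructor
  · linarith [key X (flipBit X i) fun t ht => (t.eval_flipBit X ht).symm]
  · linarith [key (flipBit X i) X fun t ht => t.eval_flipBit X ht]

theorem sum_queryProb_le (A : RandomizedAlgorithm n) (X : Fin n → Bool) :
    ∑ i, A.queryProb i X ≤ A.expectedQueries X := by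
  unfold queryProb expectedQueries
  rw [← Summable.tsum_finsetSum fun _ _ => ENNReal.summable]
  refine ENNReal.tsum_le_tsum fun t => ?_
  rw [Finset.sum_ite_mem, Finset.univ_inter, Finset.sum_const, nsmul_eq_mul, mul_comm]
  gcongr
  exact t.card_queried_le X

theorem expectedQueries_le (A : RandomizedAlgorithm n) {T : ℕ} (h : A.MakesAtMost T)
    (X : Fin n → Bool) : A.expectedQueries X ≤ T := by
  calc A.expectedQueries X ≤ ∑' t : DecisionTree n, A t * (T : ℝ≥0∞) := by
        refine ENNReal.tsum_le_tsum fun t => ?_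
        by_cases ht : t ∈ A.support
        · gcongr
          exact h X t ht
        · rw [PMF.apply_eq_zero_iff A t |>.2 ht, zero_mul, zero_mul]
    _ = T := by rw [ENNReal.tsum_mul_right, PMF.tsum_coe, one_mul]

/-- Weak parity takes at least `√n / 3` expected classical queries on some input. -/
theorem exists_sqrt_le_expectedQueries (A : RandomizedAlgorithm n) {ε : ℝ} (hε : 0 < ε)
    (h : SolvesWeakParity A.acceptProb ε) :
    ∃ X, ENNReal.ofReal (1 / 3 * √n) ≤ A.expectedQueries X := by
  -- Both query probabilities are at least `1/3`, and `(a ^ 2 + b ^ 2) / 3 ≥ 2 / 3 * (a * b)`.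
  obtain ⟨X, hX⟩ := exists_le_sum_cost (h.two_pow_lt hε) (fun i X => (A.queryProb i X).toReal)
    (fun _ _ => ENNReal.toReal_nonneg) (κ := 2 / 3) (fun i x hx hy a b ha hb => by
      have hsep := separated_of_success hx hy
      have h1 := A.abs_acceptProb_sub_le i x
      have h2 := A.abs_acceptProb_sub_le i (flipBit x i)
      rw [flipBit_flipBit] at h2
      rw [abs_le] at h1 h2
      have h3 : 1 / 3 ≤ (A.queryProb i x).toReal := by rcases hsep with h | h <;> linarith
      have h4 : 1 / 3 ≤ (A.queryProb i (flipBit x i)).toReal := by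
        rcases hsep with h | h <;> linarith
      nlinarith [sq_nonneg (a - b), mul_le_mul_of_nonneg_left h3 (sq_nonneg a),
        mul_le_mul_of_nonneg_left h4 (sq_nonneg b)]) (by norm_num)
  refine ⟨X, le_trans (ENNReal.ofReal_le_of_le_toReal ?_) (A.sum_queryProb_le X)⟩
  rw [ENNReal.toReal_sum fun i _ => ((A.queryProb_le_one i X).trans_lt ENNReal.one_lt_top).ne]
  exact le_of_eq_of_le (by ring) hX

end RandomizedAlgorithm

/-! ### Quantum algorithms -/

/-! ### Inner products under queries and quantum operations -/

section QState

variable {n : ℕ} {W : Type*} [NormedAddCommGroup W]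

/-- The squared norm of the component of a state with index register `i`. -/
noncomputable def indexWeight (i : Fin n) (v : QState n W) : ℝ := ∑ b, ‖v (i, b)‖ ^ 2

theorem indexWeight_nonneg (i : Fin n) (v : QState n W) : 0 ≤ indexWeight i v :=
  Finset.sum_nonneg fun _ _ => sq_nonneg _

theorem sum_indexWeight (v : QState n W) : ∑ i, indexWeight i v = ‖v‖ ^ 2 := by
  rw [PiLp.norm_sq_eq_of_L2, Fintype.sum_prod_type]
  rfl

theorem norm_oracle (X : Fin n → Bool) (v : QState n W) : ‖oracle X v‖ ^ 2 = ‖v‖ ^ 2 := by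
  rw [PiLp.norm_sq_eq_of_L2, PiLp.norm_sq_eq_of_L2, Fintype.sum_prod_type, Fintype.sum_prod_type]
  refine Finset.sum_congr rfl fun j _ => ?_
  simp only [oracle]
  cases X j <;> simp [add_comm]

variable [InnerProductSpace ℂ W]

theorem re_inner_qstate (u w : QState n W) :
    (inner ℂ u w).re = ∑ j, ∑ b, (inner ℂ (u (j, b)) (w (j, b))).re := by
  rw [PiLp.inner_apply, Complex.re_sum, Fintype.sum_prod_type]

theorem abs_re_inner_le (u w : W) : |(inner ℂ u w).re| ≤ ‖u‖ * ‖w‖ :=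
  (Complex.abs_re_le_norm _).trans (norm_inner_le_norm u w)

/-- Oracles that differ in one bit change an inner product by little. -/
theorem mul_re_inner_le_oracle (X : Fin n → Bool) (i : Fin n) (u w : QState n W) {a b : ℝ}
    (ha : 0 ≤ a) (hb : 0 ≤ b) :
    a * b * (inner ℂ u w).re ≤ a * b * (inner ℂ (oracle X u) (oracle (flipBit X i) w)).re
      + (a ^ 2 * indexWeight i u + b ^ 2 * indexWeight i w) := by
  have hsum : ∀ (f : Bool → ℝ) (c : Bool), ∑ b, f (xor b c) = ∑ b, f b := by
    intro f c
    cases c <;> simp [add_comm]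
  have hne : ∀ j ∈ Finset.univ.erase i, ∑ b, (inner ℂ (u (j, b)) (w (j, b))).re
      = ∑ b, (inner ℂ (oracle X u (j, b)) (oracle (flipBit X i) w (j, b))).re := by
    intro j hj
    simp only [oracle, flipBit_of_ne X (Finset.ne_of_mem_erase hj)]
    exact (hsum (fun b => (inner ℂ (u (j, b)) (w (j, b))).re) (X j)).symm
  rw [re_inner_qstate, re_inner_qstate, ← Finset.add_sum_erase _ _ (Finset.mem_univ i),
    ← Finset.add_sum_erase _ _ (Finset.mem_univ i), Finset.sum_congr rfl hne]
  -- After the common shift by `X i` is reindexed away, the two oracles differ on index `i` by a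
  -- flip of the answer bit.
  have hoi : ∑ b, (inner ℂ (oracle X u (i, b)) (oracle (flipBit X i) w (i, b))).re
      = ∑ b, (inner ℂ (u (i, b)) (w (i, !b))).re := by
    simp only [oracle, flipBit_same]
    rw [← hsum (fun b => (inner ℂ (u (i, b)) (w (i, !b))).re) (X i)]
    refine Finset.sum_congr rfl fun b _ => ?_
    cases b <;> cases X i <;> rfl
  rw [hoi]
  -- AM-GM for each of the four inner products on index `i`; every component of `u` and of `w`
  -- occurs in exactly two of them.
  have hle : ∀ p q : W, |a * b * (inner ℂ p q).re| ≤ (a ^ 2 * ‖p‖ ^ 2 + b ^ 2 * ‖q‖ ^ 2) / 2 := by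
    intro p q
    rw [abs_mul, abs_of_nonneg (mul_nonneg ha hb)]
    have := mul_le_mul_of_nonneg_left (abs_re_inner_le p q) (mul_nonneg ha hb)
    nlinarith [sq_nonneg (a * ‖p‖ - b * ‖q‖)]
  simp only [indexWeight, Fintype.sum_bool, Bool.not_true, Bool.not_false]
  have h1 := (abs_le.1 (hle (u (i, true)) (w (i, true)))).2
  have h2 := (abs_le.1 (hle (u (i, false)) (w (i, false)))).2
  have h3 := (abs_le.1 (hle (u (i, true)) (w (i, false)))).1
  have h4 := (abs_le.1 (hle (u (i, false)) (w (i, true)))).1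
  linarith

/-- Polarization of `sum_norm_sq`. -/
theorem QOperation.sum_re_inner {K : Type*} [Fintype K] (M : QOperation n K W)
    (u w : QState n W) : ∑ k, (inner ℂ (M.op k u) (M.op k w)).re = (inner ℂ u w).re := by
  have h : ∀ p q : QState n W, (inner ℂ p q).re = (‖p + q‖ ^ 2 - ‖p - q‖ ^ 2) / 4 := by
    intro p q
    have h1 := @norm_add_sq ℂ _ _ _ _ p q
    have h2 := @norm_sub_sq ℂ _ _ _ _ p q
    simp only [RCLike.re_to_complex] at h1 h2
    linarith
  simp only [h, ← map_add, ← map_sub]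
  rw [← Finset.sum_div, Finset.sum_sub_distrib, M.sum_norm_sq, M.sum_norm_sq]

end QState

/-! ### Finite sums over the tree of measurement histories -/

section Histories

variable (K : Type*) [Fintype K]

/-- The histories of length `m`. -/
def histories : ℕ → Finset (List K)
  | 0 => {[]}
  | m + 1 => (Finset.univ ×ˢ histories m).map
      ⟨fun p => p.1 :: p.2, fun p q h => by
        obtain ⟨h1, h2⟩ := List.cons.inj h
        exact Prod.ext h1 h2⟩

variable {K}

theorem mem_histories {m : ℕ} {h : List K} : h ∈ histories K m ↔ h.length = m := by
  induction m generalizing h with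
  | zero => simp [histories]
  | succ m ih =>
    cases h with
    | nil => simp [histories]
    | cons k h =>
      simp only [histories, Finset.mem_map, Finset.mem_product, Finset.mem_univ, true_and, ih,
        Prod.exists, List.length_cons]
      constructor
      · rintro ⟨_, l, hl, he⟩
        rw [← (List.cons.inj he).2, hl]
      · exact fun hl => ⟨k, h, Nat.succ.inj hl, rfl⟩

theorem sum_histories_succ (m : ℕ) (f : List K → ℝ) :
    ∑ h ∈ histories K (m + 1), f h = ∑ h ∈ histories K m, ∑ k, f (k :: h) := by
  rw [histories, Finset.sum_map, Finset.sum_product_right]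
  rfl

variable (K) in
/-- The histories of length less than `m`. -/
def historiesLT (m : ℕ) : Finset (List K) :=
  (Finset.range m).disjiUnion (histories K) fun _ _ _ _ hij =>
    Finset.disjoint_left.2 fun _ hi hj => hij ((mem_histories.1 hi).symm.trans (mem_histories.1 hj))

theorem mem_historiesLT {m : ℕ} {h : List K} : h ∈ historiesLT K m ↔ h.length < m := by
  refine Finset.mem_disjiUnion.trans ?_
  simp [mem_histories]

theorem sum_historiesLT (m : ℕ) (f : List K → ℝ) :
    ∑ h ∈ historiesLT K m, f h = ∑ j ∈ Finset.range m, ∑ h ∈ histories K j, f h :=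
  Finset.sum_disjiUnion _ _ _

theorem tendsto_historiesLT : Filter.Tendsto (historiesLT K) Filter.atTop Filter.atTop :=
  Filter.tendsto_atTop_finset_of_monotone
    (fun _ _ hab _ hh => mem_historiesLT.2 ((mem_historiesLT.1 hh).trans_le hab))
    fun h => ⟨h.length + 1, mem_historiesLT.2 (Nat.lt_succ_self _)⟩

/-- A telescoping sum over the tree of histories. -/
theorem sum_histories_le_of_step {f g : List K → ℝ}
    (hstep : ∀ h, f h ≤ ∑ k, f (k :: h) + g h) (m : ℕ) :
    f [] ≤ ∑ h ∈ histories K m, f h + ∑ h ∈ historiesLT K m, g h := by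
  induction m with
  | zero => simp [histories, historiesLT]
  | succ m ih =>
    rw [sum_historiesLT, Finset.sum_range_succ, ← sum_historiesLT, sum_histories_succ]
    have := Finset.sum_le_sum fun h (_ : h ∈ histories K m) => hstep h
    rw [Finset.sum_add_distrib] at this
    linarith

end Histories

/-! ### Progress and query counts after finitely many steps -/

namespace QuantumProgram

variable {n : ℕ} {K W : Type*} [Fintype K] [NormedAddCommGroup W] [InnerProductSpace ℂ W]
  (A : QuantumProgram n K W)

/-- `haltProb` as a real number. -/
noncomputable def haltWeight (X : Fin n → Bool) (b : Bool) (h : List K) : ℝ :=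
  match A.instr h with
  | .output b' => if b' = b then ‖A.state X h‖ ^ 2 else 0
  | .step _ _ => 0

/-- The weight on index `i` of the state queried after the history `h`, if a query follows. -/
noncomputable def queryWeight (i : Fin n) (X : Fin n → Bool) (h : List K) : ℝ :=
  match A.instr h with
  | .output _ => 0
  | .step ask _ => if ask then indexWeight i (A.state X h) else 0

theorem haltWeight_nonneg (X : Fin n → Bool) (b : Bool) (h : List K) :
    0 ≤ A.haltWeight X b h := by
  unfold haltWeight
  split
  · split <;> positivity
  · exact le_rfl

theorem queryWeight_nonneg (i : Fin n) (X : Fin n → Bool) (h : List K) :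
    0 ≤ A.queryWeight i X h := by
  unfold queryWeight
  split
  · exact le_rfl
  · split
    · exact indexWeight_nonneg _ _
    · exact le_rfl

theorem haltProb_eq_ofReal (X : Fin n → Bool) (b : Bool) (h : List K) :
    A.haltProb X b h = ENNReal.ofReal (A.haltWeight X b h) := by
  rcases hi : A.instr h with c | ⟨ask, M⟩
  · simp only [haltProb, haltWeight, hi]
    split
    · rfl
    · exact ENNReal.ofReal_zero.symm
  · simp [haltProb, haltWeight, hi]

/-- The total probability of the histories of length `m`. -/
noncomputable def liveMass (X : Fin n → Bool) (m : ℕ) : ℝ :=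
  ∑ h ∈ histories K m, ‖A.state X h‖ ^ 2

/-- The probability of an output `b` within `m` steps. -/
noncomputable def haltMass (X : Fin n → Bool) (b : Bool) (m : ℕ) : ℝ :=
  ∑ h ∈ historiesLT K m, A.haltWeight X b h

theorem norm_state_sq_eq (X : Fin n → Bool) (h : List K) :
    ‖A.state X h‖ ^ 2 = ∑ k, ‖A.state X (k :: h)‖ ^ 2
      + (A.haltWeight X true h + A.haltWeight X false h) := by
  rcases hi : A.instr h with b | ⟨ask, M⟩
  · cases b <;> simp [state, haltWeight, hi]
  · cases ask <;> simp [state, haltWeight, hi, M.sum_norm_sq, norm_oracle]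

theorem liveMass_add_haltMass (X : Fin n → Bool) (m : ℕ) :
    A.liveMass X m + (A.haltMass X true m + A.haltMass X false m) = 1 := by
  have h0 : ‖A.state X []‖ ^ 2 = 1 := by rw [state, A.norm_init, one_pow]
  have h1 := sum_histories_le_of_step (fun h => (A.norm_state_sq_eq X h).le) m
  have h2 := sum_histories_le_of_step (f := fun h => -‖A.state X h‖ ^ 2)
    (g := fun h => -(A.haltWeight X true h + A.haltWeight X false h)) (fun h => by
      have := A.norm_state_sq_eq X h
      rw [Finset.sum_neg_distrib]
      linarith) m
  simp only [Finset.sum_neg_distrib] at h2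
  rw [Finset.sum_add_distrib] at h1 h2
  unfold liveMass haltMass
  linarith

/-- One step of the progress bound. -/
theorem mul_re_inner_state_le (X : Fin n → Bool) (i : Fin n) {a b : ℝ} (ha : 0 ≤ a) (hb : 0 ≤ b)
    (h : List K) :
    a * b * (inner ℂ (A.state X h) (A.state (flipBit X i) h)).re ≤
      ∑ k, a * b * (inner ℂ (A.state X (k :: h)) (A.state (flipBit X i) (k :: h))).re
      + (a * b * ((2 / 3 * A.haltWeight X true h + 3 / 2 * A.haltWeight (flipBit X i) true h
            + (3 / 2 * A.haltWeight X false h + 2 / 3 * A.haltWeight (flipBit X i) false h)) / 2)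
        + (a ^ 2 * A.queryWeight i X h + b ^ 2 * A.queryWeight i (flipBit X i) h)) := by
  rw [← Finset.mul_sum]
  have hab := mul_nonneg ha hb
  have hin := (abs_le.1 (abs_re_inner_le (A.state X h) (A.state (flipBit X i) h))).2
  rcases hi : A.instr h with c | ⟨ask, M⟩
  · have hs : ∀ (Y : Fin n → Bool) (k : K), A.state Y (k :: h) = 0 := fun Y k => by
      simp [state, hi]
    have hq : ∀ Y : Fin n → Bool, A.queryWeight i Y h = 0 := fun Y => by simp [queryWeight, hi]
    have hw : ∀ (Y : Fin n → Bool) (d : Bool),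
        A.haltWeight Y d h = if c = d then ‖A.state Y h‖ ^ 2 else 0 := fun Y d => by
      simp [haltWeight, hi]
    simp only [hs, hq, hw, inner_zero_left, Complex.zero_re, Finset.sum_const_zero, mul_zero,
      add_zero, zero_add]
    refine mul_le_mul_of_nonneg_left (hin.trans ?_) hab
    -- AM-GM with ratio `2/3` on acceptance and `3/2` on rejection. Unequal weights make the bound
    -- smaller than `1` when the first input is accepted sufficiently more often; being linear in
    -- the probabilities, it survives summation and limits.
    cases c
    · simp only [Bool.false_eq_true, if_false, if_true]
      nlinarith [sq_nonneg (3 * ‖A.state X h‖ - 2 * ‖A.state (flipBit X i) h‖)]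
    · simp only [Bool.true_eq_false, if_false, if_true]
      nlinarith [sq_nonneg (2 * ‖A.state X h‖ - 3 * ‖A.state (flipBit X i) h‖)]
  · cases ask
    · simp [state, haltWeight, queryWeight, hi, M.sum_re_inner]
    · simpa [state, haltWeight, queryWeight, hi, M.sum_re_inner] using
        mul_re_inner_le_oracle X i (A.state X h) (A.state (flipBit X i) h) ha hb

/-- The expected weight on index `i` of the queries made within `m` steps. -/
noncomputable def queryMass (i : Fin n) (X : Fin n → Bool) (m : ℕ) : ℝ :=
  ∑ h ∈ historiesLT K m, A.queryWeight i X h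

/-- The progress bound after `m` steps. -/
theorem mul_le_of_steps (X : Fin n → Bool) (i : Fin n) {a b : ℝ} (ha : 0 ≤ a) (hb : 0 ≤ b)
    (m : ℕ) :
    a * b ≤ a * b * ((A.liveMass X m + A.liveMass (flipBit X i) m) / 2)
      + (a * b * ((2 / 3 * A.haltMass X true m + 3 / 2 * A.haltMass (flipBit X i) true m
            + (3 / 2 * A.haltMass X false m + 2 / 3 * A.haltMass (flipBit X i) false m)) / 2)
        + (a ^ 2 * A.queryMass i X m + b ^ 2 * A.queryMass i (flipBit X i) m)) := by
  have h := sum_histories_le_of_step (fun h => A.mul_re_inner_state_le X i ha hb h) m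
  have h0 : (inner ℂ (A.state X []) (A.state (flipBit X i) [])).re = 1 := by
    rw [state, state, ← RCLike.re_to_complex, inner_self_eq_norm_sq, A.norm_init, one_pow]
  have h1 : ∑ h ∈ histories K m, a * b * (inner ℂ (A.state X h) (A.state (flipBit X i) h)).re
      ≤ a * b * ((A.liveMass X m + A.liveMass (flipBit X i) m) / 2) := by
    unfold liveMass
    rw [← Finset.sum_add_distrib, Finset.sum_div, Finset.mul_sum]
    refine Finset.sum_le_sum fun h _ => mul_le_mul_of_nonneg_left ?_ (mul_nonneg ha hb)
    have := (abs_le.1 (abs_re_inner_le (A.state X h) (A.state (flipBit X i) h))).2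
    nlinarith [sq_nonneg (‖A.state X h‖ - ‖A.state (flipBit X i) h‖)]
  rw [h0, mul_one] at h
  simp only [Finset.sum_add_distrib, ← Finset.mul_sum, ← Finset.sum_div] at h
  rw [← Finset.mul_sum] at h1
  unfold haltMass queryMass
  linarith

theorem numQueries_le_length (h : List K) : A.numQueries h ≤ h.length := by
  induction h with
  | nil => simp [numQueries]
  | cons k h ih =>
    rw [numQueries, List.length_cons]
    split
    · omega
    · split <;> omega

/-- One step of the count of the queries made within the first `c` steps. -/
theorem state_sq_mul_numQueries_le (X : Fin n → Bool) (c : ℕ) (h : List K) :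
    ‖A.state X h‖ ^ 2 * (min (A.numQueries h) c : ℕ) ≤
      ∑ k, ‖A.state X (k :: h)‖ ^ 2 * (min (A.numQueries (k :: h)) c : ℕ)
      + ((A.haltWeight X true h + A.haltWeight X false h) * (A.numQueries h : ℝ)
        - if h.length < c then ∑ i, A.queryWeight i X h else 0) := by
  have hmin : ((min (A.numQueries h) c : ℕ) : ℝ) ≤ A.numQueries h := by
    exact_mod_cast min_le_left _ _
  rcases hi : A.instr h with b | ⟨ask, M⟩
  · have hq : ∑ i, A.queryWeight i X h = 0 :=
      Finset.sum_eq_zero fun i _ => by simp [queryWeight, hi]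
    have hs : ∀ k, A.state X (k :: h) = 0 := fun k => by simp [state, hi]
    have hw : A.haltWeight X true h + A.haltWeight X false h = ‖A.state X h‖ ^ 2 := by
      simp [A.norm_state_sq_eq X h, hs]
    rw [hq, hw, ite_self, sub_zero]
    simp only [hs, norm_zero]
    simpa using mul_le_mul_of_nonneg_left hmin (sq_nonneg ‖A.state X h‖)
  · have hw : ∀ b, A.haltWeight X b h = 0 := fun b => by simp [haltWeight, hi]
    have hsum : ∑ k, ‖A.state X (k :: h)‖ ^ 2 = ‖A.state X h‖ ^ 2 := by
      simp [A.norm_state_sq_eq X h, hw]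
    have hn : ∀ k, A.numQueries (k :: h) = A.numQueries h + if ask then 1 else 0 := fun k => by
      simp [numQueries, hi]
    simp only [hn, ← Finset.sum_mul, hsum, hw]
    have hq : ∑ i, A.queryWeight i X h = if ask then ‖A.state X h‖ ^ 2 else 0 := by
      cases ask <;> simp [queryWeight, hi, sum_indexWeight]
    rw [hq]
    have hl := A.numQueries_le_length h
    cases ask
    · simp
    · simp only [if_true, add_zero, zero_mul, zero_sub]
      -- Before step `c` the number of queries is below `c`, so the cap is inactive and the query
      -- adds exactly one.
      split
      · rw [min_eq_left (by omega), min_eq_left (by omega)]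
        push_cast
        linarith
      · have : ((min (A.numQueries h) c : ℕ) : ℝ) ≤ (min (A.numQueries h + 1) c : ℕ) := by
          exact_mod_cast min_le_min_right c (Nat.le_succ _)
        simpa using mul_le_mul_of_nonneg_left this (sq_nonneg ‖A.state X h‖)

/-- The expected number of the queries followed by an output within `m` steps. -/
noncomputable def haltedQueries (X : Fin n → Bool) (m : ℕ) : ℝ :=
  ∑ h ∈ historiesLT K m,
    (A.haltWeight X true h + A.haltWeight X false h) * (A.numQueries h : ℝ)

/-- The count is capped at `c` so that the histories still running at time `m` contribute at most
`c` times their mass, which tends to `0` for an algorithm that halts almost surely. -/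
theorem sum_queryMass_le (X : Fin n → Bool) {c m : ℕ} (hcm : c ≤ m) :
    ∑ i, A.queryMass i X c ≤ c * A.liveMass X m + A.haltedQueries X m := by
  have h := sum_histories_le_of_step (fun h => A.state_sq_mul_numQueries_le X c h) m
  have h1 : ∑ h ∈ histories K m, ‖A.state X h‖ ^ 2 * ((min (A.numQueries h) c : ℕ) : ℝ)
      ≤ c * A.liveMass X m := by
    rw [liveMass, Finset.mul_sum]
    refine Finset.sum_le_sum fun h _ => ?_
    rw [mul_comm]
    refine mul_le_mul_of_nonneg_right ?_ (sq_nonneg _)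
    exact_mod_cast min_le_right _ _
  have h2 : ∑ h ∈ historiesLT K m, (if h.length < c then ∑ i, A.queryWeight i X h else 0)
      = ∑ i, A.queryMass i X c := by
    unfold queryMass
    rw [Finset.sum_comm, ← Finset.sum_filter]
    refine Finset.sum_congr ?_ fun _ _ => rfl
    ext h
    rw [Finset.mem_filter, mem_historiesLT, mem_historiesLT]
    omega
  rw [Finset.sum_sub_distrib, h2] at h
  simp only [numQueries, Nat.zero_min, Nat.cast_zero, mul_zero] at h
  unfold haltedQueries
  linarith

end QuantumProgram

/-! ### Passage to the limit for programs that halt almost surely -/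

namespace QuantumAlgorithm

variable {n : ℕ} {K W : Type*} [Fintype K] [NormedAddCommGroup W] [InnerProductSpace ℂ W]
  (A : QuantumAlgorithm n K W)

theorem outputProb_ne_top (X : Fin n → Bool) (b : Bool) : A.outputProb X b ≠ ∞ := by
  have h := A.halts X
  have h' : A.outputProb X true + A.outputProb X false ≠ ∞ := h ▸ ENNReal.one_ne_top
  rw [ENNReal.add_ne_top] at h'
  cases b
  exacts [h'.2, h'.1]

theorem tendsto_haltMass (X : Fin n → Bool) (b : Bool) :
    Filter.Tendsto (A.haltMass X b) Filter.atTop (nhds (A.outputProb X b).toReal) := by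
  have h1 : Filter.Tendsto (fun m => ∑ h ∈ historiesLT K m, A.haltProb X b h) Filter.atTop
      (nhds (A.outputProb X b)) :=
    (ENNReal.summable.hasSum : HasSum (A.haltProb X b) _).comp tendsto_historiesLT
  refine ((ENNReal.tendsto_toReal (A.outputProb_ne_top X b)).comp h1).congr fun m => ?_
  simp only [Function.comp, QuantumProgram.haltProb_eq_ofReal]
  rw [← ENNReal.ofReal_sum_of_nonneg fun h _ => A.haltWeight_nonneg X b h,
    ENNReal.toReal_ofReal (Finset.sum_nonneg fun h _ => A.haltWeight_nonneg X b h)]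
  rfl

theorem toReal_outputProb_false (X : Fin n → Bool) :
    (A.outputProb X false).toReal = 1 - A.acceptProb X := by
  have h := congrArg ENNReal.toReal (A.halts X)
  rw [ENNReal.toReal_add (A.outputProb_ne_top X true) (A.outputProb_ne_top X false),
    ENNReal.toReal_one] at h
  unfold acceptProb
  linarith

theorem tendsto_liveMass (X : Fin n → Bool) :
    Filter.Tendsto (A.liveMass X) Filter.atTop (nhds 0) := by
  have h := ((A.tendsto_haltMass X true).add (A.tendsto_haltMass X false)).const_sub 1
  rw [A.toReal_outputProb_false, acceptProb, add_sub_cancel, sub_self] at h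
  exact h.congr fun m => by linarith [A.liveMass_add_haltMass X m]

theorem haltedQueries_le (X : Fin n → Bool) (hX : A.expectedQueries X ≠ ∞) (m : ℕ) :
    A.haltedQueries X m ≤ (A.expectedQueries X).toReal := by
  have hterm : ∀ h : List K,
      ENNReal.ofReal ((A.haltWeight X true h + A.haltWeight X false h) * (A.numQueries h : ℝ))
        = (A.haltProb X true h + A.haltProb X false h) * (A.numQueries h : ℝ≥0∞) := by
    intro h
    have h1 := A.haltWeight_nonneg X true h
    have h2 := A.haltWeight_nonneg X false h
    rw [A.haltProb_eq_ofReal, A.haltProb_eq_ofReal, ← ENNReal.ofReal_add h1 h2,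
      ENNReal.ofReal_mul (add_nonneg h1 h2), ENNReal.ofReal_natCast]
  rw [← ENNReal.ofReal_le_iff_le_toReal hX, QuantumProgram.haltedQueries,
    ENNReal.ofReal_sum_of_nonneg fun h _ => mul_nonneg (add_nonneg (A.haltWeight_nonneg X true h)
      (A.haltWeight_nonneg X false h)) (Nat.cast_nonneg _)]
  simp only [hterm]
  exact ENNReal.sum_le_tsum _

theorem sum_queryMass_le_expectedQueries (X : Fin n → Bool) (hX : A.expectedQueries X ≠ ∞)
    (m : ℕ) : ∑ i, A.queryMass i X m ≤ (A.expectedQueries X).toReal := by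
  have h := ((A.tendsto_liveMass X).const_mul (m : ℝ)).add_const (A.expectedQueries X).toReal
  rw [mul_zero, zero_add] at h
  refine ge_of_tendsto h ?_
  filter_upwards [Filter.eventually_ge_atTop m] with M hM
  linarith [A.sum_queryMass_le X hM, A.haltedQueries_le X hX M]

/-- The masses increase with `m`, and finite expected cost bounds them. -/
theorem exists_tendsto_queryMass (X : Fin n → Bool) (hX : A.expectedQueries X ≠ ∞) (i : Fin n) :
    ∃ q, Filter.Tendsto (A.queryMass i X) Filter.atTop (nhds q) := by
  have hnn : ∀ j m, 0 ≤ A.queryMass j X m := fun j m =>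
    Finset.sum_nonneg fun h _ => A.queryWeight_nonneg j X h
  have hmono : Monotone (A.queryMass i X) := fun a b hab =>
    Finset.sum_le_sum_of_subset_of_nonneg
      (fun h hh => mem_historiesLT.2 ((mem_historiesLT.1 hh).trans_le hab))
      fun h _ _ => A.queryWeight_nonneg i X h
  refine ⟨_, tendsto_atTop_ciSup hmono ⟨(A.expectedQueries X).toReal, ?_⟩⟩
  rintro _ ⟨m, rfl⟩
  exact (Finset.single_le_sum (fun j _ => hnn j m) (Finset.mem_univ i)).trans
    (A.sum_queryMass_le_expectedQueries X hX m)

/-- If the acceptance probabilities at the ends of an edge differ by at least `1 / 3`, then the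
expected query weights on its direction are large. -/
theorem mul_le_of_separated (X : Fin n → Bool) (i : Fin n) {a b q r : ℝ} (ha : 0 ≤ a)
    (hb : 0 ≤ b) (h : A.acceptProb (flipBit X i) + 1 / 3 ≤ A.acceptProb X)
    (hq : Filter.Tendsto (A.queryMass i X) Filter.atTop (nhds q))
    (hr : Filter.Tendsto (A.queryMass i (flipBit X i)) Filter.atTop (nhds r)) :
    1 / 18 * (a * b) ≤ a ^ 2 * q + b ^ 2 * r := by
  have hl := (((A.tendsto_liveMass X).add (A.tendsto_liveMass (flipBit X i))).div_const
    2).const_mul (a * b)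
  have hh := (((((A.tendsto_haltMass X true).const_mul (2 / 3)).add
    ((A.tendsto_haltMass (flipBit X i) true).const_mul (3 / 2))).add
    (((A.tendsto_haltMass X false).const_mul (3 / 2)).add
    ((A.tendsto_haltMass (flipBit X i) false).const_mul (2 / 3)))).div_const 2).const_mul (a * b)
  have hlim := ge_of_tendsto (hl.add (hh.add ((hq.const_mul (a ^ 2)).add (hr.const_mul (b ^ 2)))))
    (Filter.Eventually.of_forall fun m => A.mul_le_of_steps X i ha hb m)
  rw [A.toReal_outputProb_false, A.toReal_outputProb_false] at hlim
  change a * b ≤ a * b * ((0 + 0) / 2) + (a * b * ((2 / 3 * A.acceptProb X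
    + 3 / 2 * A.acceptProb (flipBit X i) + (3 / 2 * (1 - A.acceptProb X)
    + 2 / 3 * (1 - A.acceptProb (flipBit X i)))) / 2) + (a ^ 2 * q + b ^ 2 * r)) at hlim
  -- With `δ ≥ 1/3` the gap in acceptance probability, the halting term is `(13/6 - 5/6 * δ) / 2 ≤
  -- 17/18`, which leaves `1/18`.
  nlinarith [mul_le_mul_of_nonneg_left h (mul_nonneg ha hb)]

theorem expectedQueries_le {T : ℕ} (h : A.MakesAtMost T) (X : Fin n → Bool) :
    A.expectedQueries X ≤ T := by
  have hsum : ∑' h : List K, (A.haltProb X true h + A.haltProb X false h) = 1 := by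
    rw [ENNReal.tsum_add]
    exact A.halts X
  calc A.expectedQueries X
      ≤ ∑' h : List K, (A.haltProb X true h + A.haltProb X false h) * (T : ℝ≥0∞) := by
        refine ENNReal.tsum_le_tsum fun l => ?_
        by_cases hl : A.state X l = 0
        · have : ∀ b, A.haltProb X b l = 0 := fun b => by
            unfold QuantumProgram.haltProb
            split <;> simp [hl]
          simp [this]
        · gcongr
          exact h X l hl
    _ = T := by rw [ENNReal.tsum_mul_right, hsum, one_mul]

/-- Weak parity takes at least `√n / 36` expected quantum queries on some input. -/
theorem exists_sqrt_le_expectedQueries {ε : ℝ} (hε : 0 < ε)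
    (h : SolvesWeakParity A.acceptProb ε) :
    ∃ X, ENNReal.ofReal (1 / 36 * √n) ≤ A.expectedQueries X := by
  -- An input of infinite expected cost is itself a witness; otherwise the limits `q i X` exist.
  by_cases htop : ∃ X, A.expectedQueries X = ∞
  · obtain ⟨X, hX⟩ := htop
    exact ⟨X, hX ▸ le_top⟩
  · rw [not_exists] at htop
    choose q hq using fun i X => A.exists_tendsto_queryMass X (htop X) i
    have hq0 : ∀ i X, 0 ≤ q i X := fun i X => ge_of_tendsto (hq i X)
      (Filter.Eventually.of_forall fun m =>
        Finset.sum_nonneg fun h _ => A.queryWeight_nonneg i X h)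
    obtain ⟨X, hX⟩ := exists_le_sum_cost (h.two_pow_lt hε) q hq0 (κ := 1 / 18)
      (fun i x hx hy a b ha hb => by
        rcases separated_of_success hx hy with hs | hs
        -- `mul_le_of_separated` wants the likelier accepted end first, so here the ends and the
        -- weights `a`, `b` trade places.
        · have := A.mul_le_of_separated (flipBit x i) i hb ha (by rwa [flipBit_flipBit])
            (hq i _) (hq i _)
          rw [flipBit_flipBit] at this
          linarith
        · exact A.mul_le_of_separated x i ha hb hs (hq i _) (hq i _)) (by norm_num)
    have hsum : ∑ i, q i X ≤ (A.expectedQueries X).toReal :=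
      le_of_tendsto (tendsto_finsetSum _ fun i _ => hq i X)
        (Filter.Eventually.of_forall fun m => A.sum_queryMass_le_expectedQueries X (htop X) m)
    refine ⟨X, ENNReal.ofReal_le_of_le_toReal (le_trans ?_ hsum)⟩
    exact le_of_eq_of_le (by ring) hX

end QuantumAlgorithm

theorem mainTheorem6 :
    -- randomized, bounded error
    (∃ c : ℝ, 0 < c ∧ ∀ (n : ℕ) (ε : ℝ), 0 < ε → ∀ (A : RandomizedAlgorithm n) (T : ℕ),
      (∀ X, A.acceptProb X ∈ Set.Icc (0 : ℝ) (1 / 3) ∪ Set.Icc (2 / 3 : ℝ) 1) →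
      SolvesWeakParity A.acceptProb ε → A.MakesAtMost T →
      c * (n : ℝ) ^ (1 / 3 : ℝ) ≤ (T : ℝ)) ∧
    -- quantum, bounded error
    (∃ c : ℝ, 0 < c ∧ ∀ (n : ℕ) (ε : ℝ), 0 < ε →
      ∀ (K W : Type*) [Fintype K] [NormedAddCommGroup W] [InnerProductSpace ℂ W]
        (A : QuantumAlgorithm n K W) (T : ℕ),
      (∀ X, A.acceptProb X ∈ Set.Icc (0 : ℝ) (1 / 3) ∪ Set.Icc (2 / 3 : ℝ) 1) →
      SolvesWeakParity A.acceptProb ε → A.MakesAtMost T →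
      c * (n : ℝ) ^ (1 / 6 : ℝ) ≤ (T : ℝ)) ∧
    -- randomized, acceptance probability exactly `0` or `1`, expected number of queries
    (∃ c : ℝ, 0 < c ∧ ∀ (n : ℕ) (ε : ℝ), 0 < ε → ∀ A : RandomizedAlgorithm n,
      (∀ X, A.acceptProb X ∈ ({0, 1} : Set ℝ)) →
      SolvesWeakParity A.acceptProb ε →
      ∃ X, ENNReal.ofReal (c * (n : ℝ) ^ (1 / 2 : ℝ)) ≤ A.expectedQueries X) ∧
    -- quantum, acceptance probability exactly `0` or `1`, expected number of queries
    (∃ c : ℝ, 0 < c ∧ ∀ (n : ℕ) (ε : ℝ), 0 < ε →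
      ∀ (K W : Type*) [Fintype K] [NormedAddCommGroup W] [InnerProductSpace ℂ W]
        (A : QuantumAlgorithm n K W),
      (∀ X, A.acceptProb X ∈ ({0, 1} : Set ℝ)) →
      SolvesWeakParity A.acceptProb ε →
      ∃ X, ENNReal.ofReal (c * (n : ℝ) ^ (1 / 3 : ℝ)) ≤ A.expectedQueries X) := by
  -- The constants are those of the `√n` bounds; all the exponents are at most `1/2`.
  refine ⟨⟨1 / 3, by norm_num, ?_⟩, ⟨1 / 36, by norm_num, ?_⟩, ⟨1 / 3, by norm_num, ?_⟩,
    ⟨1 / 36, by norm_num, ?_⟩⟩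
  · intro n ε hε A T _ hA hT
    obtain ⟨X, hX⟩ := A.exists_sqrt_le_expectedQueries hε hA
    have h := hX.trans (A.expectedQueries_le hT X)
    rw [← ENNReal.ofReal_natCast, ENNReal.ofReal_le_ofReal_iff (Nat.cast_nonneg _)] at h
    exact le_trans (by gcongr; exact rpow_le_sqrt (by norm_num) (by norm_num) n) h
  · intro n ε hε K W _ _ _ A T _ hA hT
    obtain ⟨X, hX⟩ := A.exists_sqrt_le_expectedQueries hε hA
    have h := hX.trans (A.expectedQueries_le hT X)
    rw [← ENNReal.ofReal_natCast, ENNReal.ofReal_le_ofReal_iff (Nat.cast_nonneg _)] at h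
    exact le_trans (by gcongr; exact rpow_le_sqrt (by norm_num) (by norm_num) n) h
  · intro n ε hε A _ hA
    obtain ⟨X, hX⟩ := A.exists_sqrt_le_expectedQueries hε hA
    refine ⟨X, le_trans (ENNReal.ofReal_le_ofReal ?_) hX⟩
    gcongr
    exact rpow_le_sqrt (by norm_num) (by norm_num) n
  · intro n ε hε K W _ _ _ A _ hA
    obtain ⟨X, hX⟩ := A.exists_sqrt_le_expectedQueries hε hA
    refine ⟨X, le_trans (ENNReal.ofReal_le_ofReal ?_) hX⟩
    gcongr
    exact rpow_le_sqrt (by norm_num) (by norm_num) n
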